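/- Let $\Bbbk$ be a field and $A$ a finite-dimensional unital associative $\Bbbk$-algebra; for a finite-dimensional algebra $R$ write $R\text{-mod}$ for the category of finitely generated left $R$-modules. All endofunctors are additive and $\Bbbk$-linear; an endofunctor $F$ is called selfadjoint if it is adjoint to itself, and selfadjoint endofunctors form a category whose morphisms are all natural transformations. Let $X\in A\text{-mod}$ be projective and injective, put $B=\mathrm{End}_A(X)^{\mathrm{op}}$, let $\mathrm{add}(X)$ be the class of direct summands of finite direct sums of copies of $X$, and let $\mathcal X$ be the full subcategory of $A\text{-mod}$ of all $Y$ that admit an exact sequence $X_1\to X_0\to Y\to 0$ with $X_0,X_1\in\mathrm{add}(X)$. Let $\Phi=\mathrm{Hom}_A(X,-):\mathcal X\to B\text{-mod}$. Assume that $A$ has the double centralizer property for $X$, i.e. that there is an exact sequence $0\to {}_AA\to X_0\to X_1$ with $X_0,X_1\in\mathrm{add}(X)$. Then $\Phi$ is an equivalence; every selfadjoint endofunctor $F$ of $A\text{-mod}$ maps $\mathcal X$ to $\mathcal X$; the endofunctor $\overline F:=\Phi\circ F|_{\mathcal X}\circ\Phi^{-1}$ of $B\text{-mod}$ is selfadjoint;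 and the functor $F\mapsto\overline F$, $\xi\mapsto\overline\xi:=\Phi\,\xi|_{\mathcal X}\,\Phi^{-1}$, from the category of selfadjoint endofunctors of $A\text{-mod}$ to the category of selfadjoint endofunctors of $B\text{-mod}$ is full and faithful. -/

import Mathlib

open CategoryTheory

universe w u

namespace SelfadjointRestriction

noncomputable section

/-- An additive and `k`-linear endofunctor `F` of a `k`-linear category is selfadjoint if it is
adjoint to itself. -/
def IsSelfadjoint (k : Type*) [CommRing k] {C : Type*} [Category C] [Preadditive C] [Linear k C] :
    ObjectProperty (C ⥤ C) := fun F =>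
  ∃ _ : F.Additive, F.Linear k ∧ Nonempty (F ⊣ F)

/-- The category of selfadjoint (additive, `k`-linear) endofunctors of `C`;
the morphisms are all natural transformations. -/
abbrev SelfadjointEndofunctor (k : Type*) [CommRing k] (C : Type*) [Category C] [Preadditive C]
    [Linear k C] :=
  (IsSelfadjoint k (C := C)).FullSubcategory

/-- The restriction of an endofunctor to a full subcategory that it preserves. -/
abbrev restrict {C : Type*} [Category C] (P : ObjectProperty C) (F : C ⥤ C)
    (hF : ∀ Y, P Y → P (F.obj Y)) : P.FullSubcategory ⥤ P.FullSubcategory :=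
  P.lift (P.ι ⋙ F) fun Y => hF Y.obj Y.property

/-- The restriction of a natural transformation to a preserved full subcategory. -/
abbrev restrictMap {C : Type*} [Category C] (P : ObjectProperty C) {F G : C ⥤ C}
    (hF : ∀ Y, P Y → P (F.obj Y)) (hG : ∀ Y, P Y → P (G.obj Y)) (ξ : F ⟶ G) :
    restrict P F hF ⟶ restrict P G hG where
  app Y := ObjectProperty.homMk (ξ.app Y.obj)
  naturality _ _ f := ObjectProperty.hom_ext _ (ξ.naturality f.hom)

section Modules

variable {A : Type u} [Ring A]

/-- `add(X)`: the modules that are direct summands of finite direct sums of copies of `X`. -/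
def addClosure (X : FGModuleCat.{u} A) : ObjectProperty (FGModuleCat.{u} A) := fun Y =>
  ∃ (n : ℕ) (i : Y →ₗ[A] (Fin n → X)) (p : (Fin n → X) →ₗ[A] Y), p ∘ₗ i = LinearMap.id

/-- The modules `Y` that have a presentation `X₁ → X₀ → Y → 0` (exact) with `X₀, X₁` in `add(X)`. -/
def presentedBy (X : FGModuleCat.{u} A) : ObjectProperty (FGModuleCat.{u} A) := fun Y =>
  ∃ X₁ X₀ : FGModuleCat.{u} A, addClosure X X₁ ∧ addClosure X X₀ ∧
    ∃ (f : X₁ →ₗ[A] X₀) (g : X₀ →ₗ[A] Y), Function.Exact f g ∧ Function.Surjective g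

/-- `A` has the double centralizer property for `X`: there is an exact sequence
`0 → A → X₀ → X₁` of left `A`-modules with `X₀, X₁` in `add(X)`. -/
def HasDoubleCentralizerProperty (X : FGModuleCat.{u} A) : Prop :=
  ∃ X₀ X₁ : FGModuleCat.{u} A, addClosure X X₀ ∧ addClosure X X₁ ∧
    ∃ (ι : A →ₗ[A] X₀) (α : X₀ →ₗ[A] X₁), Function.Injective ι ∧ Function.Exact ι α

/-- The algebra `B = End_A(X)ᵒᵖ`. Multiplication in `End X` is composition of maps. -/
abbrev OppositeEnd (X : FGModuleCat.{u} A) : Type u := (End X)ᵐᵒᵖ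

open scoped ModuleCat in
/-- `Hom_A(X, Y)` is finitely generated over `B = End_A(X)ᵒᵖ`. -/
theorem finite_hom (k : Type w) [Field k] [Algebra k A] [Module.Finite k A]
    (X Y : FGModuleCat.{u} A) : Module.Finite (OppositeEnd X) (X ⟶ Y) := by
  have hX : Module.Finite k X.obj := Module.Finite.trans A X.obj
  have hY : Module.Finite k Y.obj := Module.Finite.trans A Y.obj
  have hXY : Module.Finite k (X ⟶ Y) :=
    Module.Finite.of_injective
      ({ toFun := fun (f : X ⟶ Y) => f.hom.hom.restrictScalars k
         map_add' := fun _ _ => rfl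
         map_smul' := fun _ _ => rfl } : (X ⟶ Y) →ₗ[k] (X.obj →ₗ[k] Y.obj))
      (fun f g h => FGModuleCat.hom_ext (LinearMap.restrictScalars_injective k h))
  have : IsScalarTower k (OppositeEnd X) (X ⟶ Y) :=
    ⟨fun c b f => Linear.smul_comp _ _ _ c b.unop f⟩
  exact Module.Finite.of_restrictScalars_finite k (OppositeEnd X) (X ⟶ Y)

variable (k : Type w) [Field k] [Algebra k A] [Module.Finite k A]

/-- The functor `Hom_A(X, -)` from `A-mod` to `B-mod`, `B = End_A(X)ᵒᵖ`; the action of `b` in `B`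
on a homomorphism is precomposition with `b`. -/
def homFunctor (X : FGModuleCat.{u} A) : FGModuleCat.{u} A ⥤ FGModuleCat.{u} (OppositeEnd X) :=
  (ModuleCat.isFG (OppositeEnd X)).lift (preadditiveCoyonedaObj X) (finite_hom k X)

/-- `Φ`: the functor `Hom_A(X, -)` on the modules presented by `add(X)`. -/
def presentedHomFunctor (X : FGModuleCat.{u} A) :
    (presentedBy X).FullSubcategory ⥤ FGModuleCat.{u} (OppositeEnd X) :=
  (presentedBy X).ι ⋙ homFunctor k X

/-- `F̄ = Φ F Φ⁻¹`: the endofunctor of `B-mod` induced by an endofunctor `F` of `A-mod` which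
preserves the modules presented by `add(X)`, when `Φ` is an equivalence. -/
def bar (X : FGModuleCat.{u} A) [(presentedHomFunctor k X).IsEquivalence]
    (F : FGModuleCat.{u} A ⥤ FGModuleCat.{u} A)
    (hF : ∀ Y, presentedBy X Y → presentedBy X (F.obj Y)) :
    FGModuleCat.{u} (OppositeEnd X) ⥤ FGModuleCat.{u} (OppositeEnd X) :=
  (presentedHomFunctor k X).inv ⋙ restrict (presentedBy X) F hF ⋙ presentedHomFunctor k X

/-- `ξ̄ = Φ ξ Φ⁻¹` for a natural transformation `ξ : F ⟶ G`. -/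
def barMap (X : FGModuleCat.{u} A) [(presentedHomFunctor k X).IsEquivalence]
    {F G : FGModuleCat.{u} A ⥤ FGModuleCat.{u} A}
    (hF : ∀ Y, presentedBy X Y → presentedBy X (F.obj Y))
    (hG : ∀ Y, presentedBy X Y → presentedBy X (G.obj Y)) (ξ : F ⟶ G) :
    bar k X F hF ⟶ bar k X G hG :=
  Functor.whiskerLeft (presentedHomFunctor k X).inv
    (Functor.whiskerRight (restrictMap (presentedBy X) hF hG ξ) (presentedHomFunctor k X))

/-- The functor `F ↦ F̄` from selfadjoint endofunctors of `A-mod` to selfadjoint endofunctors of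
`B-mod`, defined as soon as `Φ` is an equivalence, selfadjoint endofunctors `F` of `A-mod` preserve
the modules presented by `add(X)`, and the induced endofunctors `F̄` of `B-mod` are selfadjoint. -/
def barFunctor (X : FGModuleCat.{u} A) [(presentedHomFunctor k X).IsEquivalence]
    (hpres : ∀ F : SelfadjointEndofunctor k (FGModuleCat.{u} A),
      ∀ Y, presentedBy X Y → presentedBy X (F.obj.obj Y))
    (hself : ∀ F : SelfadjointEndofunctor k (FGModuleCat.{u} A),
      IsSelfadjoint k (bar k X F.obj (hpres F))) :
    SelfadjointEndofunctor k (FGModuleCat.{u} A) ⥤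
      SelfadjointEndofunctor k (FGModuleCat.{u} (OppositeEnd X)) where
  obj F := ⟨bar k X F.obj (hpres F), hself F⟩
  map {F G} ξ := ObjectProperty.homMk (barMap k X (hpres F) (hpres G) ξ.hom)
  map_id F := by
    ext Y : 3
    exact (presentedHomFunctor k X).map_id _
  map_comp ξ η := by
    ext Y : 3
    exact (presentedHomFunctor k X).map_comp _ _

end Modules

end

end SelfadjointRestriction

/-!
If `X` is projective, a right exact functor `F` is determined on the objects presented by `add X`
by the object `F X` with its action of `End X`: a map `F Y ⟶ W` amounts to an `End X`-equivariant
additive map `Hom(X, Y) → Hom(F X, W)`. Dually, if `X` is injective, a left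
exact functor `G` is determined on the objects copresented by `add X` by `G X`. Every `A`-module is
presented by `add A`, and by the double centralizer property `A` is copresented by `add X`. Since
selfadjoint functors are exact, a natural transformation `F ⟶ G` amounts to an equivariant map
`F A ⟶ G A`, hence to an equivariant map `F X ⟶ G X`, and so does a natural transformation of the
restrictions to the modules presented by `add X`.

Selfadjoint functors also preserve projective and injective objects. Hence `F X` is a summand of
copies of `A` and, being injective and embedded in copies of `X`, a summand of copies of `X`.
-/

namespace SelfadjointRestriction

open Limits Opposite

section Preadditive

variable {C D : Type*} [Category* C] [Category* D] [Preadditive C] [Preadditive D]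

/-- The class `add X` of direct summands of finite direct sums of copies of `X`, in the form
`𝟙 Y = ∑ i, u i ≫ v i` with `u i : Y ⟶ X` and `v i : X ⟶ Y`, which does not require the direct sums
to exist in `C`. -/
def summandsOfCopies (X : C) : ObjectProperty C := fun Y =>
  ∃ (n : ℕ) (u : Fin n → (Y ⟶ X)) (v : Fin n → (X ⟶ Y)), ∑ i, u i ≫ v i = 𝟙 Y

/-- The objects `Y` with a presentation `X₁ ⟶ X₀ ⟶ Y ⟶ 0` by objects of `add X`. -/
def finitelyPresentedBy (X : C) : ObjectProperty C := fun Y =>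
  ∃ X₁ X₀ : C, summandsOfCopies X X₁ ∧ summandsOfCopies X X₀ ∧
    ∃ (f : X₁ ⟶ X₀) (g : X₀ ⟶ Y) (w : f ≫ g = 0), Nonempty (IsColimit (CokernelCofork.ofπ g w))

/-- The objects `Y` with a copresentation `0 ⟶ Y ⟶ X₀ ⟶ X₁` by objects of `add X`. -/
def finitelyCopresentedBy (X : C) : ObjectProperty C := fun Y =>
  ∃ X₀ X₁ : C, summandsOfCopies X X₀ ∧ summandsOfCopies X X₁ ∧
    ∃ (f : Y ⟶ X₀) (g : X₀ ⟶ X₁) (w : f ≫ g = 0), Nonempty (IsLimit (KernelFork.ofι f w))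

namespace summandsOfCopies

theorem of_fintype {X Y : C} {ι : Type*} [Fintype ι] (u : ι → (Y ⟶ X)) (v : ι → (X ⟶ Y))
    (h : ∑ i, u i ≫ v i = 𝟙 Y) : summandsOfCopies X Y := by
  let e := Fintype.equivFin ι
  exact ⟨Fintype.card ι, u ∘ e.symm, v ∘ e.symm,
    (e.symm.sum_comp fun i => u i ≫ v i).trans h⟩

theorem of_retract {X Y : C} (r : Retract Y X) : summandsOfCopies X Y :=
  of_fintype (ι := Unit) (fun _ => r.i) (fun _ => r.r) (by simp)

theorem self (X : C) : summandsOfCopies X X :=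
  of_retract (.refl X)

protected theorem biproduct [HasFiniteBiproducts C] (X : C) (n : ℕ) :
    summandsOfCopies X (⨁ fun _ : Fin n => X) :=
  ⟨n, biproduct.π _, biproduct.ι _, biproduct.total⟩

protected theorem trans {X Y Z : C} (hY : summandsOfCopies X Y) (hZ : summandsOfCopies Y Z) :
    summandsOfCopies X Z := by
  obtain ⟨n, u, v, huv⟩ := hY
  obtain ⟨m, s, t, hst⟩ := hZ
  refine of_fintype (ι := Fin m × Fin n) (fun p => s p.1 ≫ u p.2) (fun p => v p.2 ≫ t p.1) ?_
  calc ∑ p : Fin m × Fin n, (s p.1 ≫ u p.2) ≫ v p.2 ≫ t p.1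
      = ∑ i, s i ≫ (∑ j, u j ≫ v j) ≫ t i := by
        simp only [Fintype.sum_prod_type, Preadditive.sum_comp, Preadditive.comp_sum,
          Category.assoc]
    _ = 𝟙 Z := by simp only [huv, Category.id_comp, hst]

protected theorem map {X Y : C} (hY : summandsOfCopies X Y) (F : C ⥤ D) [F.Additive] :
    summandsOfCopies (F.obj X) (F.obj Y) := by
  obtain ⟨n, u, v, huv⟩ := hY
  refine ⟨n, fun i => F.map (u i), fun i => F.map (v i), ?_⟩
  simp only [← F.map_comp, ← F.map_sum, huv, F.map_id]

protected theorem op {X Y : C} (hY : summandsOfCopies X Y) : summandsOfCopies (op X) (op Y) := by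
  obtain ⟨n, u, v, huv⟩ := hY
  exact ⟨n, fun i => (v i).op, fun i => (u i).op, by simp only [← op_comp, ← op_sum, huv, op_id]⟩

theorem exists_retract_map_obj [HasFiniteBiproducts C] {F : C ⥤ D} [F.Additive] {X : C} {Z : D}
    (hZ : summandsOfCopies (F.obj X) Z) :
    ∃ X₀, summandsOfCopies X X₀ ∧ Nonempty (Retract Z (F.obj X₀)) := by
  obtain ⟨n, u, v, huv⟩ := hZ
  let b := biproduct.bicone fun _ : Fin n => X
  refine ⟨b.pt, .biproduct X n, ⟨⟨∑ i, u i ≫ F.map (b.ι i), ∑ i, F.map (b.π i) ≫ v i, ?_⟩⟩⟩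
  have ι_π (i j : Fin n) :
      (u i ≫ F.map (b.ι i)) ≫ F.map (b.π j) ≫ v j = if i = j then u i ≫ v i else 0 := by
    rw [Category.assoc, ← F.map_comp_assoc]
    split_ifs with h
    · subst h
      rw [bicone_ι_π_self, F.map_id, Category.id_comp]
    · rw [bicone_ι_π_ne b h, F.map_zero, zero_comp, comp_zero]
  simp only [Preadditive.sum_comp, Preadditive.comp_sum, ι_π, Finset.sum_ite_eq',
    Finset.mem_univ, if_true, huv]

theorem hom_ext {X Y : C} (hY : summandsOfCopies X Y) (F : C ⥤ D) [F.Additive] {W : D}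
    {s t : F.obj Y ⟶ W} (h : ∀ x : X ⟶ Y, F.map x ≫ s = F.map x ≫ t) : s = t := by
  obtain ⟨n, u, v, huv⟩ := hY
  rw [← Category.id_comp s, ← Category.id_comp t, ← F.map_id, ← huv]
  simp only [F.map_sum, F.map_comp, Preadditive.sum_comp, Category.assoc, h]

theorem exists_map_comp_eq {X Y : C} (hY : summandsOfCopies X Y) (F : C ⥤ D) {W : D}
    (h : (X ⟶ Y) →+ (F.obj X ⟶ W)) (hh : ∀ (b : X ⟶ X) (x : X ⟶ Y), h (b ≫ x) = F.map b ≫ h x) :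
    ∃ t : F.obj Y ⟶ W, ∀ x : X ⟶ Y, F.map x ≫ t = h x := by
  obtain ⟨n, u, v, huv⟩ := hY
  refine ⟨∑ i, F.map (u i) ≫ h (v i), fun x => ?_⟩
  calc F.map x ≫ ∑ i, F.map (u i) ≫ h (v i) = h (x ≫ ∑ i, u i ≫ v i) := by
        simp only [Preadditive.comp_sum, map_sum, ← Category.assoc, hh, F.map_comp]
    _ = h x := by rw [huv, Category.comp_id]

theorem map_surjective {X Y Z : C} (hY : summandsOfCopies X Y) {F : C ⥤ D} [F.Additive]
    (hF : Function.Surjective (F.map : (X ⟶ Z) → (F.obj X ⟶ F.obj Z))) :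
    Function.Surjective (F.map : (Y ⟶ Z) → (F.obj Y ⟶ F.obj Z)) := fun φ => by
  choose lift map_lift using hF
  obtain ⟨n, u, v, huv⟩ := hY
  refine ⟨∑ i, u i ≫ lift (F.map (v i) ≫ φ), ?_⟩
  calc F.map (∑ i, u i ≫ lift (F.map (v i) ≫ φ)) = F.map (∑ i, u i ≫ v i) ≫ φ := by
        simp only [F.map_sum, F.map_comp, map_lift, Preadditive.sum_comp, Category.assoc]
    _ = φ := by rw [huv, F.map_id, Category.id_comp]

end summandsOfCopies

namespace finitelyPresentedBy

theorem of_summandsOfCopies {X Y : C} (hY : summandsOfCopies X Y) :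
    finitelyPresentedBy X Y :=
  ⟨Y, Y, hY, hY, 0, 𝟙 Y, zero_comp, ⟨CokernelCofork.IsColimit.ofId 0 rfl⟩⟩

theorem exists_epi {X Y : C} (hY : finitelyPresentedBy X Y) :
    ∃ (X₀ : C) (g : X₀ ⟶ Y), summandsOfCopies X X₀ ∧ Epi g := by
  obtain ⟨_, X₀, _, h₀, _, g, _, ⟨hg⟩⟩ := hY
  exact ⟨X₀, g, h₀, Cofork.IsColimit.epi hg⟩

protected theorem map {X Y : C} {Z : D} (hY : finitelyPresentedBy X Y) (F : C ⥤ D) [F.Additive]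
    [PreservesFiniteColimits F] (hX : summandsOfCopies Z (F.obj X)) :
    finitelyPresentedBy Z (F.obj Y) := by
  obtain ⟨X₁, X₀, h₁, h₀, f, g, w, ⟨hg⟩⟩ := hY
  exact ⟨F.obj X₁, F.obj X₀, hX.trans (h₁.map F), hX.trans (h₀.map F), F.map f, F.map g,
    by rw [← F.map_comp, w, F.map_zero], ⟨CokernelCofork.mapIsColimit _ hg F⟩⟩

theorem hom_ext {X Y : C} (hY : finitelyPresentedBy X Y) (F : C ⥤ D) [F.Additive]
    [F.PreservesEpimorphisms] {W : D} {s t : F.obj Y ⟶ W}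
    (h : ∀ x : X ⟶ Y, F.map x ≫ s = F.map x ≫ t) : s = t := by
  obtain ⟨X₀, g, h₀, _⟩ := hY.exists_epi
  rw [← cancel_epi (F.map g)]
  exact h₀.hom_ext F fun x => by simp only [← F.map_comp_assoc, h]

/-- This is the universal property of the tensor product in `F Y = F X ⊗ Hom(X, Y)` over the
endomorphisms of `X`. -/
theorem exists_map_comp_eq {X Y : C} [Projective X] (hY : finitelyPresentedBy X Y) (F : C ⥤ D)
    [F.Additive] [PreservesFiniteColimits F] {W : D} (h : (X ⟶ Y) →+ (F.obj X ⟶ W))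
    (hh : ∀ (b : X ⟶ X) (x : X ⟶ Y), h (b ≫ x) = F.map b ≫ h x) :
    ∃ t : F.obj Y ⟶ W, ∀ x : X ⟶ Y, F.map x ≫ t = h x := by
  obtain ⟨X₁, X₀, h₁, h₀, f, g, w, ⟨hg⟩⟩ := hY
  have : Epi g := Cofork.IsColimit.epi hg
  obtain ⟨t₀, ht₀⟩ : ∃ t₀ : F.obj X₀ ⟶ W, ∀ x, F.map x ≫ t₀ = h (x ≫ g) :=
    h₀.exists_map_comp_eq F (h.comp (Preadditive.rightComp X g)) fun b x =>
      (congrArg h (Category.assoc b x g)).trans (hh b (x ≫ g))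
  have f_comp_t₀ : F.map f ≫ t₀ = 0 := h₁.hom_ext F fun x => by
    rw [← F.map_comp_assoc, ht₀, Category.assoc, w, comp_zero, map_zero, comp_zero]
  obtain ⟨t, ht⟩ : ∃ t : F.obj Y ⟶ W, F.map g ≫ t = t₀ :=
    have desc := Cofork.IsColimit.desc' (CokernelCofork.mapIsColimit _ hg F) t₀
      (by rw [zero_comp]; exact f_comp_t₀)
    ⟨desc.1, desc.2⟩
  refine ⟨t, fun x => ?_⟩
  calc F.map x ≫ t = F.map (Projective.factorThru x g) ≫ t₀ := by
        rw [← ht, ← F.map_comp_assoc, Projective.factorThru_comp]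
    _ = h x := by rw [ht₀, Projective.factorThru_comp]

end finitelyPresentedBy

namespace finitelyCopresentedBy

protected theorem op {X Y : C} (hY : finitelyCopresentedBy X Y) :
    finitelyPresentedBy (op X) (op Y) := by
  obtain ⟨X₀, X₁, h₀, h₁, f, g, w, ⟨hf⟩⟩ := hY
  exact ⟨_, _, h₁.op, h₀.op, g.op, f.op, by rw [← op_comp, w, op_zero],
    ⟨KernelFork.IsLimit.ofιOp f w hf⟩⟩

theorem exists_mono {X Y : C} (hY : finitelyCopresentedBy X Y) :
    ∃ (X₀ : C) (f : Y ⟶ X₀), summandsOfCopies X X₀ ∧ Mono f := by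
  obtain ⟨X₀, _, h₀, _, f, _, _, ⟨hf⟩⟩ := hY
  exact ⟨X₀, f, h₀, Fork.IsLimit.mono hf⟩

theorem hom_ext {X Y : C} (hY : finitelyCopresentedBy X Y) (G : C ⥤ D) [G.Additive]
    [PreservesFiniteLimits G] {W : D} {s t : W ⟶ G.obj Y}
    (h : ∀ x : Y ⟶ X, s ≫ G.map x = t ≫ G.map x) : s = t := by
  have := preservesFiniteColimits_op G
  exact Quiver.Hom.op_inj (hY.op.hom_ext G.op fun x => Quiver.Hom.unop_inj (h x.unop))

theorem exists_comp_map_eq {X Y : C} [Injective X] (hY : finitelyCopresentedBy X Y) (G : C ⥤ D)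
    [G.Additive] [PreservesFiniteLimits G] {W : D} (h : (Y ⟶ X) →+ (W ⟶ G.obj X))
    (hh : ∀ (x : Y ⟶ X) (b : X ⟶ X), h (x ≫ b) = h x ≫ G.map b) :
    ∃ t : W ⟶ G.obj Y, ∀ x : Y ⟶ X, t ≫ G.map x = h x := by
  have := preservesFiniteColimits_op G
  let hOp : (op X ⟶ op Y) →+ (op (G.obj X) ⟶ op W) :=
    { toFun := fun x => (h x.unop).op
      map_zero' := by simp
      map_add' := by simp }
  obtain ⟨t, ht⟩ := hY.op.exists_map_comp_eq G.op hOp fun b x =>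
    congrArg Quiver.Hom.op (hh x.unop b.unop)
  exact ⟨t.unop, fun x => Quiver.Hom.op_inj (ht x.op)⟩

end finitelyCopresentedBy

section NatTrans

variable {P X : C} (hP : ∀ Y, finitelyPresentedBy P Y) {F G : C ⥤ D} [F.Additive]

include hP in
theorem exists_natTrans_app_eq_of_projective [Projective P] [PreservesFiniteColimits F]
    [G.Additive] (θ : F.obj P ⟶ G.obj P) (hθ : ∀ b : P ⟶ P, F.map b ≫ θ = θ ≫ G.map b) :
    ∃ ξ : F ⟶ G, ξ.app P = θ := by
  have (Y : C) : ∃ t : F.obj Y ⟶ G.obj Y, ∀ y : P ⟶ Y, F.map y ≫ t = θ ≫ G.map y :=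
    (hP Y).exists_map_comp_eq F ((Preadditive.leftComp _ θ).comp G.mapAddHom) fun b y => by
      change θ ≫ G.map (b ≫ y) = F.map b ≫ θ ≫ G.map y
      rw [G.map_comp, reassoc_of% hθ b]
  choose t ht using this
  refine ⟨{ app := t, naturality := fun Y Z f => (hP Y).hom_ext F fun y => ?_ }, ?_⟩
  · rw [← F.map_comp_assoc, ht, ← Category.assoc, ht, Category.assoc, G.map_comp]
  · simpa only [F.map_id, G.map_id, Category.id_comp, Category.comp_id] using ht P (𝟙 P)

include hP in
theorem exists_natTrans_app_eq_of_injective [Projective P] [Injective X]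
    (hXP : finitelyCopresentedBy X P) (hX : finitelyPresentedBy P X) [PreservesFiniteColimits F]
    [G.Additive] [PreservesFiniteLimits G] (θ : F.obj X ⟶ G.obj X)
    (hθ : ∀ b : X ⟶ X, F.map b ≫ θ = θ ≫ G.map b) : ∃ ξ : F ⟶ G, ξ.app X = θ := by
  obtain ⟨θP, hθP⟩ : ∃ θP : F.obj P ⟶ G.obj P, ∀ x, θP ≫ G.map x = F.map x ≫ θ :=
    hXP.exists_comp_map_eq G ((Preadditive.rightComp _ θ).comp F.mapAddHom) fun x b => by
      change F.map (x ≫ b) ≫ θ = (F.map x ≫ θ) ≫ G.map b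
      rw [F.map_comp, Category.assoc, Category.assoc, hθ]
  obtain ⟨ξ, hξ⟩ := exists_natTrans_app_eq_of_projective hP θP fun b => hXP.hom_ext G fun x => by
    rw [Category.assoc, Category.assoc, hθP, ← G.map_comp, hθP, F.map_comp, Category.assoc]
  exact ⟨ξ, hX.hom_ext F fun x => by rw [ξ.naturality, hξ, hθP]⟩

include hP in
theorem natTrans_ext_of_copresentedBy [PreservesFiniteColimits F] [G.Additive]
    [PreservesFiniteLimits G] (hXP : finitelyCopresentedBy X P) {ξ η : F ⟶ G}
    (h : ξ.app X = η.app X) : ξ = η := by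
  have app_P : ξ.app P = η.app P := hXP.hom_ext G fun x => by
    rw [← ξ.naturality, ← η.naturality, h]
  ext Y
  exact (hP Y).hom_ext F fun y => by rw [ξ.naturality, η.naturality, app_P]

include hP in
theorem bijective_whiskerLeft_ι [Projective P] [Injective X] [PreservesFiniteColimits F]
    [G.Additive] [PreservesFiniteLimits G] (hXP : finitelyCopresentedBy X P)
    (Q : ObjectProperty C) (hXQ : Q X) (hQ : Q ≤ finitelyPresentedBy X) :
    Function.Bijective fun ξ : F ⟶ G => Functor.whiskerLeft Q.ι ξ := by
  refine ⟨fun ξ η h => natTrans_ext_of_copresentedBy hP hXP (NatTrans.congr_app h ⟨X, hXQ⟩),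
    fun ζ => ?_⟩
  let ζX : F.obj X ⟶ G.obj X := ζ.app ⟨X, hXQ⟩
  have naturality_ζX {Y : Q.FullSubcategory} (x : X ⟶ Y.obj) :
      F.map x ≫ ζ.app Y = ζX ≫ G.map x :=
    ζ.naturality (X := ⟨X, hXQ⟩) (ObjectProperty.homMk x)
  obtain ⟨ξ, hξ⟩ := exists_natTrans_app_eq_of_injective hP hXP (hP X) ζX fun b =>
    naturality_ζX (Y := ⟨X, hXQ⟩) b
  refine ⟨ξ, ?_⟩
  ext Y
  exact (hQ _ Y.property).hom_ext F fun x =>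
    (ξ.naturality x).trans ((congrArg (· ≫ G.map x) hξ).trans (naturality_ζX x).symm)

end NatTrans

theorem summandsOfCopies.of_epi_of_projective {X X₀ Y : C} (h₀ : summandsOfCopies X X₀)
    (g : X₀ ⟶ Y) [Epi g] [Projective Y] : summandsOfCopies X Y :=
  h₀.trans (.of_retract ⟨Projective.factorThru (𝟙 Y) g, g, Projective.factorThru_comp _ _⟩)

theorem summandsOfCopies.of_mono_of_injective [HasFiniteBiproducts C] {P X X₀ Y : C}
    (hY : summandsOfCopies P Y) (h₀ : summandsOfCopies X X₀) (f : P ⟶ X₀) [Mono f] [Injective Y] :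
    summandsOfCopies X Y := by
  obtain ⟨n, u, v, huv⟩ := hY
  let m : Y ⟶ ⨁ fun _ : Fin n => X₀ := biproduct.lift fun i => u i ≫ f
  have : Mono m := Preadditive.mono_of_cancel_zero _ fun s hs => by
    have comp_u (i : Fin n) : s ≫ u i = 0 := by
      rw [← cancel_mono f, Category.assoc, zero_comp, ← biproduct.lift_π (fun i => u i ≫ f) i,
        reassoc_of% hs, zero_comp]
    rw [← Category.comp_id s, ← huv, Preadditive.comp_sum]
    exact Finset.sum_eq_zero fun i _ => by rw [reassoc_of% comp_u i, zero_comp]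
  exact (h₀.trans (.biproduct X₀ n)).trans
    (.of_retract ⟨m, Injective.factorThru (𝟙 Y) m, Injective.comp_factorThru _ _⟩)

end Preadditive

section Abelian

variable {C E : Type*} [Category* C] [Preadditive C] [Category* E] [Abelian E]

theorem exists_isColimit_cokernelCofork_of_forall_exists_epi {ι : Type*} {S : ι → E}
    (hS : ∀ M, ∃ (i : ι) (p : S i ⟶ M), Epi p) (M : E) :
    ∃ (i₁ i₀ : ι) (f : S i₁ ⟶ S i₀) (g : S i₀ ⟶ M) (w : f ≫ g = 0),
      Nonempty (IsColimit (CokernelCofork.ofπ g w)) := by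
  obtain ⟨i₀, g, _⟩ := hS M
  obtain ⟨i₁, p, _⟩ := hS (kernel g)
  have w : (p ≫ kernel.ι g) ≫ g = 0 := by rw [Category.assoc, kernel.condition, comp_zero]
  exact ⟨i₁, i₀, p ≫ kernel.ι g, g, w,
    ⟨isCokernelEpiComp (Abelian.epiIsCokernelOfKernel _ (kernelIsKernel g)) p rfl⟩⟩

theorem finitelyPresentedBy_of_forall_exists_epi {P : E}
    (hP : ∀ M, ∃ (S : E) (p : S ⟶ M), summandsOfCopies P S ∧ Epi p) (M : E) :
    finitelyPresentedBy P M := by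
  obtain ⟨S₁, S₀, f, g, w, hg⟩ := exists_isColimit_cokernelCofork_of_forall_exists_epi
    (S := fun S : {S : E // summandsOfCopies P S} => S.1)
    (fun M => (hP M).elim fun S ⟨p, hS, hp⟩ => ⟨⟨S, hS⟩, p, hp⟩) M
  exact ⟨S₁, S₀, S₁.2, S₀.2, f, g, w, hg⟩

theorem exists_finitelyPresentedBy_iso [HasFiniteBiproducts C] [HasCokernels C] {H : C ⥤ E}
    [H.Additive] [PreservesFiniteColimits H] {X : C}
    (hH : ∀ Z, Function.Surjective (H.map : (X ⟶ Z) → (H.obj X ⟶ H.obj Z)))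
    (hX : ∀ M, finitelyPresentedBy (H.obj X) M) (M : E) :
    ∃ Y, finitelyPresentedBy X Y ∧ Nonempty (H.obj Y ≅ M) := by
  have exists_epi (M : E) : ∃ (S : {S : C // summandsOfCopies X S}) (p : H.obj S ⟶ M), Epi p := by
    obtain ⟨M₀, p, h₀, _⟩ := (hX M).exists_epi
    obtain ⟨S, hS, ⟨r⟩⟩ := h₀.exists_retract_map_obj
    exact ⟨⟨S, hS⟩, r.r ≫ p, epi_comp _ _⟩
  obtain ⟨⟨S₁, h₁⟩, ⟨S₀, h₀⟩, φ, p, w, ⟨hp⟩⟩ :=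
    exists_isColimit_cokernelCofork_of_forall_exists_epi exists_epi M
  obtain ⟨f, rfl⟩ := h₁.map_surjective (hH S₀) φ
  refine ⟨cokernel f, ⟨S₁, S₀, h₁, h₀, f, cokernel.π f, cokernel.condition f,
    ⟨cokernelIsCokernel f⟩⟩, ⟨?_⟩⟩
  exact (CokernelCofork.mapIsColimit _ (cokernelIsCokernel f) H).coconePointUniqueUpToIso hp

end Abelian

section Selfadjoint

variable {k : Type*} [CommRing k] {C D : Type*} [Category* C] [Preadditive C] [Linear k C]
  [Category* D] [Preadditive D] [Linear k D] {F : C ⥤ C}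

namespace IsSelfadjoint

theorem additive (hF : IsSelfadjoint k F) : F.Additive := hF.1

theorem preservesFiniteColimits (hF : IsSelfadjoint k F) : PreservesFiniteColimits F := by
  obtain ⟨_, -, ⟨adj⟩⟩ := hF
  have := adj.leftAdjoint_preservesColimits.{0, 0}
  exact PreservesColimitsOfSize.preservesFiniteColimits.{0, 0} F

theorem preservesFiniteLimits (hF : IsSelfadjoint k F) : PreservesFiniteLimits F := by
  obtain ⟨_, -, ⟨adj⟩⟩ := hF
  have := adj.rightAdjoint_preservesLimits.{0, 0}
  exact PreservesLimitsOfSize.preservesFiniteLimits.{0, 0} F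

protected theorem restrict (hF : IsSelfadjoint k F) {Q : ObjectProperty C}
    (hQ : ∀ Y, Q Y → Q (F.obj Y)) :
    IsSelfadjoint k (SelfadjointRestriction.restrict Q F hQ) := by
  obtain ⟨_, _, ⟨adj⟩⟩ := hF
  exact ⟨⟨fun {_ _ _ _} => ObjectProperty.hom_ext _ F.map_add⟩,
    ⟨fun _ _ => ObjectProperty.hom_ext _ (F.map_smul _ _)⟩,
    ⟨adj.restrictFullyFaithful Q.fullyFaithfulι Q.fullyFaithfulι (Iso.refl _) (Iso.refl _)⟩⟩

theorem conj (hF : IsSelfadjoint k F) (e : C ≌ D) [e.functor.Additive] [e.functor.Linear k] :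
    IsSelfadjoint k (e.inverse ⋙ F ⋙ e.functor) := by
  obtain ⟨_, _, ⟨adj⟩⟩ := hF
  exact ⟨inferInstance, inferInstance,
    ⟨(e.symm.toAdjunction.comp (adj.comp e.toAdjunction)).ofNatIsoRight
      (Functor.associator _ _ _)⟩⟩

theorem finitelyPresentedBy_obj [HasFiniteBiproducts C] {P X Y : C}
    [Projective X] [Injective X] (hF : IsSelfadjoint k F) (hP : ∀ Y, finitelyPresentedBy P Y)
    (hXP : finitelyCopresentedBy X P) (hY : finitelyPresentedBy X Y) :
    finitelyPresentedBy X (F.obj Y) := by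
  have := hF.additive
  have := hF.preservesFiniteColimits
  have := hF.preservesFiniteLimits
  obtain ⟨adj⟩ := hF.2.2
  have : Projective (F.obj X) := adj.map_projective X inferInstance
  have : Injective (F.obj X) := adj.map_injective X inferInstance
  obtain ⟨P₀, g, hP₀, _⟩ := (hP (F.obj X)).exists_epi
  obtain ⟨X₀, f, hX₀, _⟩ := hXP.exists_mono
  exact hY.map F ((hP₀.of_epi_of_projective g).of_mono_of_injective hX₀ f)

end IsSelfadjoint

end Selfadjoint

theorem bijective_restrictMap {C : Type*} [Category* C] {Q : ObjectProperty C} {F G : C ⥤ C}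
    (hF : ∀ Y, Q Y → Q (F.obj Y)) (hG : ∀ Y, Q Y → Q (G.obj Y))
    (h : Function.Bijective fun ξ : F ⟶ G => Functor.whiskerLeft Q.ι ξ) :
    Function.Bijective (restrictMap Q hF hG : (F ⟶ G) → _) := by
  refine ⟨fun ξ η e => h.1 ?_, fun ζ => ?_⟩
  · ext Y
    exact congrArg (fun t => t.hom) (NatTrans.congr_app e Y)
  · obtain ⟨ξ, hξ⟩ := h.2 (Functor.whiskerRight ζ Q.ι)
    exact ⟨ξ, NatTrans.ext (funext fun Y =>
      ObjectProperty.hom_ext _ (NatTrans.congr_app hξ Y))⟩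

section Modules

variable {A : Type u} [Ring A]

theorem hom_hom_sum {X Y : FGModuleCat.{u} A} {ι : Type*} (s : Finset ι) (f : ι → (X ⟶ Y)) :
    (∑ i ∈ s, f i).hom.hom = ∑ i ∈ s, (f i).hom.hom :=
  map_sum (⟨⟨fun g => g.hom.hom, rfl⟩, fun _ _ => rfl⟩ : (X ⟶ Y) →+ (X →ₗ[A] Y)) f s

theorem addClosure_eq_summandsOfCopies (X : FGModuleCat.{u} A) :
    addClosure X = summandsOfCopies X := by
  ext Y
  constructor
  · rintro ⟨n, i, p, h⟩
    refine ⟨n, fun j => FGModuleCat.ofHom (LinearMap.proj j ∘ₗ i),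
      fun j => FGModuleCat.ofHom (p ∘ₗ LinearMap.single A (fun _ => X) j), ?_⟩
    ext y
    rw [hom_hom_sum]
    simp only [LinearMap.sum_apply]
    change ∑ j, p (Pi.single j (i y j)) = y
    rw [← map_sum, Finset.univ_sum_single]
    exact LinearMap.congr_fun h y
  · rintro ⟨n, u, v, h⟩
    refine ⟨n, LinearMap.pi fun j => (u j).hom.hom,
      ∑ j, (v j).hom.hom ∘ₗ LinearMap.proj j, ?_⟩
    have sum_eq_id := congrArg (fun f : Y ⟶ Y => f.hom.hom) h
    rw [hom_hom_sum] at sum_eq_id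
    ext y
    simpa using LinearMap.congr_fun sum_eq_id y

theorem comp_eq_zero_of_exact {X Y Z : FGModuleCat.{u} A} {f : X ⟶ Y} {g : Y ⟶ Z}
    (h : Function.Exact f.hom.hom g.hom.hom) : f ≫ g = 0 :=
  FGModuleCat.hom_ext h.linearMap_comp_eq_zero

section Noetherian

variable [IsNoetherianRing A] {X Y Z : FGModuleCat.{u} A}

theorem exact_iff_function_exact (S : ShortComplex (FGModuleCat.{u} A)) :
    S.Exact ↔ Function.Exact S.f.hom.hom S.g.hom.hom := by
  rw [← S.exact_map_iff_of_faithful (forget₂ (FGModuleCat A) (ModuleCat A)),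
    ShortComplex.ShortExact.moduleCat_exact_iff_function_exact]
  rfl

theorem epi_iff_surjective (f : X ⟶ Y) : Epi f ↔ Function.Surjective f.hom.hom := by
  rw [← Functor.epi_map_iff_epi (forget₂ (FGModuleCat A) (ModuleCat A)),
    ModuleCat.epi_iff_surjective]
  rfl

theorem mono_iff_injective (f : X ⟶ Y) : Mono f ↔ Function.Injective f.hom.hom := by
  rw [← Functor.mono_map_iff_mono (forget₂ (FGModuleCat A) (ModuleCat A)),
    ModuleCat.mono_iff_injective]
  rfl

theorem presentedBy_eq_finitelyPresentedBy (X : FGModuleCat.{u} A) :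
    presentedBy X = finitelyPresentedBy X := by
  ext Y
  simp only [presentedBy, finitelyPresentedBy, addClosure_eq_summandsOfCopies]
  constructor
  · rintro ⟨X₁, X₀, h₁, h₀, f, g, hfg, hg⟩
    let S := ShortComplex.mk (FGModuleCat.ofHom f) (FGModuleCat.ofHom g)
      (comp_eq_zero_of_exact hfg)
    have : Epi S.g := (epi_iff_surjective _).2 hg
    exact ⟨X₁, X₀, h₁, h₀, S.f, S.g, S.zero, ⟨((exact_iff_function_exact S).2 hfg).gIsCokernel⟩⟩
  · rintro ⟨X₁, X₀, h₁, h₀, f, g, w, ⟨hg⟩⟩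
    exact ⟨X₁, X₀, h₁, h₀, f.hom.hom, g.hom.hom,
      (exact_iff_function_exact _).1 (ShortComplex.exact_of_g_is_cokernel (.mk f g w) hg),
      (epi_iff_surjective g).1 (Cofork.IsColimit.epi hg)⟩

theorem HasDoubleCentralizerProperty.finitelyCopresentedBy {X : FGModuleCat.{u} A}
    (h : HasDoubleCentralizerProperty X) : finitelyCopresentedBy X (FGModuleCat.of A A) := by
  obtain ⟨X₀, X₁, h₀, h₁, a, α, ha, hex⟩ := h
  rw [addClosure_eq_summandsOfCopies] at h₀ h₁
  let S := ShortComplex.mk (FGModuleCat.ofHom (V := A) a) (FGModuleCat.ofHom α)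
    (comp_eq_zero_of_exact hex)
  have : Mono S.f := (mono_iff_injective _).2 ha
  exact ⟨X₀, X₁, h₀, h₁, S.f, S.g, S.zero, ⟨((exact_iff_function_exact S).2 hex).fIsKernel⟩⟩

instance projective_regular : Projective (FGModuleCat.of A A) where
  factors f e he := by
    obtain ⟨h, hh⟩ := Module.projective_lifting_property e.hom.hom f.hom.hom
      ((epi_iff_surjective e).1 he)
    exact ⟨FGModuleCat.ofHom h, FGModuleCat.hom_ext hh⟩

theorem finitelyPresentedBy_regular (Y : FGModuleCat.{u} A) :
    finitelyPresentedBy (FGModuleCat.of A A) Y := by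
  refine finitelyPresentedBy_of_forall_exists_epi (fun M => ?_) Y
  obtain ⟨n, f, hf⟩ := Module.Finite.exists_fin' A M
  refine ⟨FGModuleCat.of A (Fin n → A), FGModuleCat.ofHom f, ?_, (epi_iff_surjective _).2 hf⟩
  rw [← addClosure_eq_summandsOfCopies]
  exact ⟨n, LinearMap.id, LinearMap.id, rfl⟩

end Noetherian

end Modules

section HomFunctor

variable {A : Type u} [Ring A] (k : Type w) [Field k] [Algebra k A] [Module.Finite k A]
  (X : FGModuleCat.{u} A)

include k in
open scoped ModuleCat in
theorem isNoetherianRing_oppositeEnd : IsNoetherianRing (OppositeEnd X) := by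
  have : Module.Finite k X.obj := Module.Finite.trans A X.obj
  let toLinear : End X →ₗ[k] (X.obj →ₗ[k] X.obj) :=
    { toFun := fun f => f.hom.hom.restrictScalars k
      map_add' := fun _ _ => rfl
      map_smul' := fun _ _ => rfl }
  have : Module.Finite k (End X) := Module.Finite.of_injective toLinear fun f g h =>
    FGModuleCat.hom_ext (LinearMap.restrictScalars_injective k h)
  exact .of_finite k _

instance : (homFunctor k X).Additive where
  map_add {_ _ f g} := FGModuleCat.hom_ext <| LinearMap.ext fun x =>
    Preadditive.comp_add _ _ _ x f g

instance : (homFunctor k X).Linear k where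
  map_smul {Y _} f r := by
    have h (x : X ⟶ Y) : x ≫ (r • f) = (r • 𝟙 X) ≫ x ≫ f := by
      rw [Linear.comp_smul, Linear.smul_comp, Category.id_comp]
    exact FGModuleCat.hom_ext (LinearMap.ext h)

instance : (presentedHomFunctor k X).Additive :=
  inferInstanceAs ((presentedBy X).ι ⋙ homFunctor k X).Additive

instance : (presentedHomFunctor k X).Linear k :=
  inferInstanceAs (((presentedBy X).ι ⋙ homFunctor k X).Linear k)

instance preservesFiniteColimits_homFunctor [Projective X] :
    PreservesFiniteColimits (homFunctor k X) := by
  have := IsNoetherianRing.of_finite k A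
  have := isNoetherianRing_oppositeEnd k X
  have : PreservesFiniteColimits
      (homFunctor k X ⋙ forget₂ (FGModuleCat (OppositeEnd X)) (ModuleCat (OppositeEnd X))) :=
    inferInstanceAs (PreservesFiniteColimits (preadditiveCoyonedaObj X))
  exact preservesFiniteColimits_of_reflects_of_preserves (homFunctor k X)
    (forget₂ (FGModuleCat (OppositeEnd X)) (ModuleCat (OppositeEnd X)))

/-- The identification of `Hom_A(X, X)` with `B` as a left `B`-module: precomposition with `b` is
left multiplication by `b` in `B = End_A(X)ᵒᵖ`. -/
def homFunctorObjSelfIso :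
    (homFunctor k X).obj X ≅ FGModuleCat.of (OppositeEnd X) (OppositeEnd X) :=
  have := finite_hom k X X
  LinearEquiv.toFGModuleCatIso (V := X ⟶ X) (W := OppositeEnd X)
    { toFun := MulOpposite.op
      invFun := MulOpposite.unop
      map_add' := fun _ _ => rfl
      map_smul' := fun _ _ => rfl }

theorem homFunctor_map_surjective [Projective X] {Y Z : FGModuleCat.{u} A}
    (hY : finitelyPresentedBy X Y) :
    Function.Surjective ((homFunctor k X).map : (Y ⟶ Z) → _) := fun φ => by
  let φHom : (X ⟶ Y) →ₗ[OppositeEnd X] (X ⟶ Z) := φ.hom.hom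
  obtain ⟨t, ht⟩ := hY.exists_map_comp_eq (𝟭 _) φHom.toAddMonoidHom fun b x =>
    φHom.map_smul (MulOpposite.op b) x
  exact ⟨t, FGModuleCat.hom_ext (LinearMap.ext ht)⟩

theorem finitelyPresentedBy_homFunctor_obj_self (M : FGModuleCat.{u} (OppositeEnd X)) :
    finitelyPresentedBy ((homFunctor k X).obj X) M := by
  have := isNoetherianRing_oppositeEnd k X
  obtain ⟨X₁, X₀, h₁, h₀, pres⟩ := finitelyPresentedBy_regular M
  have regular := summandsOfCopies.of_retract (homFunctorObjSelfIso k X).symm.retract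
  exact ⟨X₁, X₀, regular.trans h₁, regular.trans h₀, pres⟩

theorem isEquivalence_presentedHomFunctor [Projective X] :
    (presentedHomFunctor k X).IsEquivalence := by
  have := IsNoetherianRing.of_finite k A
  have : HasFiniteBiproducts (FGModuleCat.{u} A) := Abelian.hasFiniteBiproducts
  have := isNoetherianRing_oppositeEnd k X
  have presented (Y : (presentedBy X).FullSubcategory) : finitelyPresentedBy X Y.obj :=
    presentedBy_eq_finitelyPresentedBy X ▸ Y.property
  have full : (presentedHomFunctor k X).Full := ⟨fun {Y Z} φ => by
    obtain ⟨t, ht⟩ := homFunctor_map_surjective k X (presented Y) φ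
    exact ⟨ObjectProperty.homMk t, ht⟩⟩
  have faithful : (presentedHomFunctor k X).Faithful := ⟨fun {Y Z} s t h =>
    ObjectProperty.hom_ext _ <| (presented Y).hom_ext (𝟭 _) fun x =>
      LinearMap.congr_fun (congrArg (fun φ => φ.hom.hom) h) x⟩
  have essSurj : (presentedHomFunctor k X).EssSurj := ⟨fun M => by
    obtain ⟨Y, hY, ⟨e⟩⟩ := exists_finitelyPresentedBy_iso (H := homFunctor k X)
      (fun Z => homFunctor_map_surjective k X (.of_summandsOfCopies (.self X)))
      (finitelyPresentedBy_homFunctor_obj_self k X) M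
    exact ⟨⟨Y, presentedBy_eq_finitelyPresentedBy X ▸ hY⟩, ⟨e⟩⟩⟩
  exact {}

end HomFunctor

section Bar

variable {A : Type u} [Ring A] {k : Type w} [Field k] [Algebra k A] [Module.Finite k A]
  {X : FGModuleCat.{u} A} {F G : FGModuleCat.{u} A ⥤ FGModuleCat.{u} A}

theorem IsSelfadjoint.presentedBy_obj [Projective X] [Injective X]
    (hF : IsSelfadjoint k F) (hdc : HasDoubleCentralizerProperty X) {Y : FGModuleCat.{u} A}
    (hY : presentedBy X Y) : presentedBy X (F.obj Y) := by
  have := IsNoetherianRing.of_finite k A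
  have : HasFiniteBiproducts (FGModuleCat.{u} A) := Abelian.hasFiniteBiproducts
  rw [presentedBy_eq_finitelyPresentedBy] at hY ⊢
  exact hF.finitelyPresentedBy_obj finitelyPresentedBy_regular hdc.finitelyCopresentedBy hY

variable [(presentedHomFunctor k X).IsEquivalence]

protected theorem IsSelfadjoint.bar (hF : IsSelfadjoint k F)
    (hpres : ∀ Y, presentedBy X Y → presentedBy X (F.obj Y)) :
    IsSelfadjoint k (bar k X F hpres) :=
  let e := (presentedHomFunctor k X).asEquivalence
  have : e.functor.Additive := inferInstanceAs (presentedHomFunctor k X).Additive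
  have : e.functor.Linear k := inferInstanceAs ((presentedHomFunctor k X).Linear k)
  (hF.restrict hpres).conj e

theorem bijective_barMap [Injective X] (hdc : HasDoubleCentralizerProperty X)
    (hF : IsSelfadjoint k F) (hG : IsSelfadjoint k G)
    (hpresF : ∀ Y, presentedBy X Y → presentedBy X (F.obj Y))
    (hpresG : ∀ Y, presentedBy X Y → presentedBy X (G.obj Y)) :
    Function.Bijective (barMap k X hpresF hpresG) := by
  have := IsNoetherianRing.of_finite k A
  have := hF.additive
  have := hF.preservesFiniteColimits
  have := hG.additive
  have := hG.preservesFiniteLimits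
  have presentedBy_self : presentedBy X X :=
    presentedBy_eq_finitelyPresentedBy X ▸ .of_summandsOfCopies (.self X)
  have restrictMap_bijective := bijective_restrictMap hpresF hpresG <|
    bijective_whiskerLeft_ι finitelyPresentedBy_regular hdc.finitelyCopresentedBy (presentedBy X)
      presentedBy_self (presentedBy_eq_finitelyPresentedBy X).le
  let Φ := presentedHomFunctor k X
  have whiskerRight_bijective := Functor.FullyFaithful.map_bijective
    (.ofFullyFaithful ((Functor.whiskeringRight _ _ _).obj Φ))
    (restrict (presentedBy X) F hpresF) (restrict (presentedBy X) G hpresG)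
  have whiskerLeft_bijective := Functor.FullyFaithful.map_bijective
    (.ofFullyFaithful ((Functor.whiskeringLeft _ _ _).obj Φ.inv))
    (restrict (presentedBy X) F hpresF ⋙ Φ) (restrict (presentedBy X) G hpresG ⋙ Φ)
  exact whiskerLeft_bijective.comp (whiskerRight_bijective.comp restrictMap_bijective)

theorem barFunctor_full_faithful (hpres : ∀ F : SelfadjointEndofunctor k (FGModuleCat.{u} A),
      ∀ Y, presentedBy X Y → presentedBy X (F.obj.obj Y))
    (hself : ∀ F : SelfadjointEndofunctor k (FGModuleCat.{u} A),
      IsSelfadjoint k (bar k X F.obj (hpres F)))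
    (h : ∀ F G : SelfadjointEndofunctor k (FGModuleCat.{u} A),
      Function.Bijective (barMap k X (hpres F) (hpres G))) :
    (barFunctor k X hpres hself).Full ∧ (barFunctor k X hpres hself).Faithful :=
  ⟨⟨fun {F G} η => (h F G).surjective η.hom |>.elim fun ξ hξ =>
      ⟨ObjectProperty.homMk ξ, ObjectProperty.hom_ext _ hξ⟩⟩,
    ⟨fun {F G} _ _ e => ObjectProperty.hom_ext _ <|
      (h F G).injective (congrArg (fun t => t.hom) e)⟩⟩

end Bar

end SelfadjointRestriction

open SelfadjointRestriction in
theorem mainTheorem6 {k : Type w} [Field k] {A : Type u} [Ring A] [Algebra k A]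
    [Module.Finite k A] (X : FGModuleCat.{u} A) (hproj : Projective X) (hinj : Injective X)
    (hdc : HasDoubleCentralizerProperty X) :
    ∃ (_ : (presentedHomFunctor k X).IsEquivalence)
      (hpres : ∀ F : SelfadjointEndofunctor k (FGModuleCat.{u} A),
        ∀ Y, presentedBy X Y → presentedBy X (F.obj.obj Y))
      (hself : ∀ F : SelfadjointEndofunctor k (FGModuleCat.{u} A),
        IsSelfadjoint k (bar k X F.obj (hpres F))),
      (barFunctor k X hpres hself).Full ∧ (barFunctor k X hpres hself).Faithful := by
  have isEquivalence := isEquivalence_presentedHomFunctor k X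
  have hpres (F : SelfadjointEndofunctor k (FGModuleCat.{u} A)) (Y) (hY : presentedBy X Y) :
      presentedBy X (F.obj.obj Y) := F.property.presentedBy_obj hdc hY
  have hself (F : SelfadjointEndofunctor k (FGModuleCat.{u} A)) :
      IsSelfadjoint k (bar k X F.obj (hpres F)) := F.property.bar (hpres F)
  exact ⟨isEquivalence, hpres, hself, barFunctor_full_faithful hpres hself fun F G =>
    bijective_barMap hdc F.property G.property (hpres F) (hpres G)⟩
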